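/- Let $H^2$ be the Hardy space of the unit disk, identified through boundary values with the closed subspace of $L^2(\mathbb T)$ of functions whose Fourier coefficients of negative index vanish, and let $P_+$ be the orthogonal projection of $L^2(\mathbb T)$ onto $H^2$. For $\chi\in L^\infty(\mathbb T)$ let $T_\chi f=P_+(\chi f)$ be the Toeplitz operator on $H^2$ and let $\mathcal M(\chi)=T_\chi H^2$ be its range. Let $S=T_{e^{it}}$ be the shift operator on $H^2$, $S^*$ its adjoint, and let $(1-z)^\alpha$ denote the principal branch. Then for every integer $n\ge 1$ and every real $\alpha$ with $n-\tfrac12<\alpha<n+\tfrac12$, $$\mathcal M\big(\overline{(1-z)^\alpha}\big)=\mathcal M\big((1-z)^\alpha\big)+\operatorname{span}\{S^*(1-z)^\alpha,\dots,S^{*n}(1-z)^\alpha\}$$ as vector subspaces of $H^2$. -/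

import Mathlib

open MeasureTheory AddCircle
open scoped ENNReal Real InnerProductSpace

noncomputable section

namespace HardyToeplitz

instance two_pi_fact : Fact (0 < 2 * π) := ⟨Real.two_pi_pos⟩

/-- The unit circle, parametrized by `t ↦ e^{it}` with `t ∈ ℝ / 2πℤ`. -/
abbrev Circ : Type := AddCircle (2 * π)

/-- Normalized arc length measure `dt / 2π` on the circle. -/
abbrev arc : Measure Circ := haarAddCircle

/-- The Hardy space `H²`, as the subspace of `L²` of the circle consisting of the functions
(the boundary functions) whose Fourier coefficients of negative index vanish. -/
def H2 : Submodule ℂ (Lp ℂ 2 arc) where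
  carrier := {f | ∀ m : ℤ, m < 0 → fourierCoeff f m = 0}
  add_mem' := by
    intro f g hf hg m hm
    have h1 := hf m hm
    have h2 := hg m hm
    rw [← fourierBasis_repr] at h1 h2 ⊢
    simp [h1, h2]
  zero_mem' := by
    intro m _
    rw [← fourierBasis_repr]
    simp
  smul_mem' := by
    intro c f hf m hm
    have h1 := hf m hm
    rw [← fourierBasis_repr] at h1 ⊢
    simp [h1]

theorem mem_H2 (f : Lp ℂ 2 arc) : f ∈ H2 ↔ ∀ m : ℤ, m < 0 → fourierCoeff f m = 0 := Iff.rfl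

theorem isClosed_H2 : IsClosed (H2 : Set (Lp ℂ 2 arc)) := by
  have h : (H2 : Set (Lp ℂ 2 arc)) =
      ⋂ (m : ℤ) (_ : m < 0), {f | ⟪(fourierBasis (T := 2 * π)) m, f⟫_ℂ = 0} := by
    ext f
    simp only [SetLike.mem_coe, mem_H2, Set.mem_iInter, Set.mem_ofPred_eq,
      ← HilbertBasis.repr_apply_apply, fourierBasis_repr]
  rw [h]
  refine isClosed_iInter fun m => isClosed_iInter fun _ => ?_
  exact isClosed_eq (continuous_const.inner continuous_id) continuous_const

instance completeSpace_H2 : CompleteSpace H2 := isClosed_H2.completeSpace_coe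

/-- Multiplication of `L²` functions by a symbol `χ ∈ L^∞`. -/
def mulOp (χ : Lp ℂ ∞ arc) : Lp ℂ 2 arc →L[ℂ] Lp ℂ 2 arc :=
  (ContinuousLinearMap.mul ℂ ℂ).holderL arc ∞ 2 2 χ

theorem mulOp_coe (χ : Lp ℂ ∞ arc) (f : Lp ℂ 2 arc) :
    mulOp χ f =ᵐ[arc] fun x => χ x * f x := by
  simpa [mulOp] using (ContinuousLinearMap.mul ℂ ℂ).coeFn_holder (r := 2) χ f

/-- The Toeplitz operator `T_χ f = P₊ (χ f)` on `H²`, where `P₊` is the orthogonal projection of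
`L²` onto `H²`. -/
def toeplitz (χ : Lp ℂ ∞ arc) : H2 →L[ℂ] H2 :=
  H2.orthogonalProjectionOnto ∘L mulOp χ ∘L H2.subtypeL

/-- The space `M(χ)`: the range of `T_χ`, as a vector subspace of `H²`. -/
def rangeSpace (χ : Lp ℂ ∞ arc) : Submodule ℂ H2 :=
  LinearMap.range (toeplitz χ : H2 →ₗ[ℂ] H2)

/-- The shift operator `S = T_χ` with symbol `χ = e^{it}`. -/
def shift : H2 →L[ℂ] H2 := toeplitz (fourierLp ∞ 1)

/-- The adjoint `S*` of the shift. -/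
def backwardShift : H2 →L[ℂ] H2 := ContinuousLinearMap.adjoint shift

theorem continuousOn_oneSubPow {α : ℝ} (hα : 0 < α) :
    ContinuousOn (fun z : ℂ => (1 - z) ^ (α : ℂ)) (Metric.closedBall 0 1) := by
  intro z hz
  apply ContinuousAt.continuousWithinAt
  rcases eq_or_ne z 1 with rfl | h1
  · have h0 : ContinuousAt (fun w : ℂ => w ^ (α : ℂ)) (1 - 1) := by
      have := Complex.continuousAt_cpow_zero_of_re_pos (z := (α : ℂ)) (by simpa using hα)
      have h2 : ContinuousAt (fun w : ℂ => (w, (α : ℂ))) 0 := by fun_prop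
      rw [sub_self]
      exact ContinuousAt.comp (f := fun w : ℂ => (w, (α : ℂ)))
        (g := fun p : ℂ × ℂ => p.1 ^ p.2) this h2
    exact ContinuousAt.comp (f := fun z : ℂ => 1 - z) (g := fun w : ℂ => w ^ (α : ℂ)) h0
      (by fun_prop)
  · have hs : (1 - z) ∈ Complex.slitPlane := by
      rw [Complex.mem_slitPlane_iff]
      by_contra! h
      have hz' : ‖z‖ ≤ 1 := by simpa using hz
      have hre := (Complex.re_le_norm z).trans hz'
      have h3 := h.1
      have h4 := h.2
      simp at h3 h4
      exact h1 (Complex.ext (by simp; linarith) (by simpa using h4))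
    exact ContinuousAt.cpow (by fun_prop) continuousAt_const hs

theorem diffContOnCl_oneSubPow {α : ℝ} (hα : 0 < α) :
    DiffContOnCl ℂ (fun z : ℂ => (1 - z) ^ (α : ℂ)) (Metric.ball 0 1) := by
  refine ⟨fun z hz => ?_, ?_⟩
  · apply DifferentiableAt.differentiableWithinAt
    have hs : (1 - z) ∈ Complex.slitPlane := by
      rw [Complex.mem_slitPlane_iff]
      left
      have hz' : ‖z‖ < 1 := by simpa using hz
      have hre := (Complex.re_le_norm z).trans_lt hz'
      simpa using hre
    exact DifferentiableAt.cpow (by fun_prop) (by fun_prop) hs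
  · rw [closure_ball _ one_ne_zero]
    exact continuousOn_oneSubPow hα

/-- The boundary function on the circle of `(1 - z)^α`, `α > 0`, with the principal branch of the
power (it takes the value `0` at `z = 1`). -/
def oneSubPow (α : ℝ) (hα : 0 < α) : C(Circ, ℂ) where
  toFun x := (1 - (toCircle x : ℂ)) ^ (α : ℂ)
  continuous_toFun := by
    refine (continuousOn_oneSubPow hα).comp_continuous
      (f := fun x : Circ => (toCircle x : ℂ)) ?_ ?_
    · exact continuous_induced_dom.comp AddCircle.continuous_toCircle
    · intro x
      rw [mem_closedBall_zero_iff]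
      exact (Circle.norm_coe _).le

/-- `(1 - z)^α` as an `L^∞` symbol. -/
def oneSubPowSymbol (α : ℝ) (hα : 0 < α) : Lp ℂ ∞ arc :=
  ContinuousMap.toLp ∞ arc ℂ (oneSubPow α hα)

theorem oneSubPow_mem_H2 (α : ℝ) (hα : 0 < α) :
    ContinuousMap.toLp 2 arc ℂ (oneSubPow α hα) ∈ H2 := by
  intro m hm
  rw [fourierCoeff_toLp, fourierCoeff_eq_intervalIntegral _ m 0]
  obtain ⟨k, rfl⟩ : ∃ k : ℕ, m = -((k : ℤ) + 1) := ⟨(-m - 1).toNat, by omega⟩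
  have hd : DiffContOnCl ℂ (fun z : ℂ => z ^ k * (1 - z) ^ (α : ℂ)) (Metric.ball 0 1) :=
    (((differentiable_id (𝕜 := ℂ) (E := ℂ)).pow k).diffContOnCl).smul (diffContOnCl_oneSubPow hα)
  have h0 := hd.circleIntegral_eq_zero zero_le_one
  rw [circleIntegral] at h0
  have key : ∀ θ : ℝ, deriv (circleMap 0 1) θ •
        (circleMap 0 1 θ ^ k * (1 - circleMap 0 1 θ) ^ (α : ℂ)) =
      Complex.I * ((fourier (- -((k : ℤ) + 1)) (θ : Circ) : ℂ) • oneSubPow α hα (θ : Circ)) := by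
    intro θ
    have hc : (toCircle (θ : Circ) : ℂ) = circleMap 0 1 θ := by
      rw [toCircle_apply_mk, Circle.coe_exp, circleMap]
      have : 2 * π / (2 * π) * θ = θ := by field_simp
      rw [this]
      simp
    simp only [deriv_circleMap, neg_neg, fourier_apply, oneSubPow, ContinuousMap.coe_mk, smul_eq_mul,
      toCircle_zsmul, Circle.coe_zpow, hc]
    rw [← Nat.cast_succ, zpow_natCast, pow_succ]
    ring
  simp_rw [key] at h0
  rw [intervalIntegral.integral_const_mul, mul_eq_zero] at h0
  rw [zero_add, h0.resolve_left Complex.I_ne_zero, smul_zero]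

/-- `(1 - z)^α` as an element of `H²`. -/
def oneSubPowVec (α : ℝ) (hα : 0 < α) : H2 :=
  ⟨ContinuousMap.toLp 2 arc ℂ (oneSubPow α hα), oneSubPow_mem_H2 α hα⟩

theorem exponent_pos {n : ℕ} {α : ℝ} (hn : 1 ≤ n) (h : (n : ℝ) - 1 / 2 < α) : 0 < α := by
  have : (1 : ℝ) ≤ n := by exact_mod_cast hn
  linarith

end HardyToeplitz

end

/-!
Write `a = (1 - z)^α`. On the circle `z̄ = -exp (-2i arg (1 - z))`, so that
`ā ψ = z̄ⁿ a` with `ψ = (-1)ⁿ exp (2i(α - n) arg (1 - z))` (`star_oneSubPow_mul`). Since `ā` is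
co-analytic and `a` is analytic, Toeplitz operators multiply here:
`T_ā T_ψ = T_{z̄ⁿ a} = S*ⁿ T_a` (`toeplitz_star_oneSubPowSymbol_mul_argSymbol`).

As `|arg (1 - z)| ≤ π/2` and `|α - n| < 1/2`, the values of `(-1)ⁿ ψ` have real part at least
`cos (π |α - n|) > 0`. Hence the quadratic form of `T_ψ` is bounded below and `T_ψ` is invertible by
Lax–Milgram (`isUnit_toeplitz`), and the range of `T_ā` is that of `S*ⁿ T_a`.

That range is found by induction on `n` (`range_backwardShift_pow_mul_toeplitz`): splitting
`f = S g + c` gives `S*ⁿ⁺¹ T_a f = S*ⁿ T_a g + c S*ⁿ⁺¹ a`, because `T_a` commutes with `S`,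
`S* S = 1` and `T_a 1 = a`, so each step adjoins exactly the line spanned by `S*ⁿ⁺¹ a`.
-/

open MeasureTheory AddCircle
open scoped ENNReal Real InnerProductSpace

noncomputable section

namespace HardyToeplitz

/-! ### Multiplication operators -/

theorem inner_mulOp_left (χ : Lp ℂ ∞ arc) (f g : Lp ℂ 2 arc) :
    ⟪mulOp χ f, g⟫_ℂ = ⟪f, mulOp (star χ) g⟫_ℂ := by
  rw [L2.inner_def, L2.inner_def]
  refine integral_congr_ae ?_
  filter_upwards [mulOp_coe χ f, mulOp_coe (star χ) g, Lp.coeFn_star χ] with x h1 h2 h3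
  rw [h1, h2, h3]
  simp
  ring

theorem mulOp_mulOp {χ ψ ω : Lp ℂ ∞ arc} (h : ∀ᵐ x ∂arc, χ x * ψ x = ω x) (f : Lp ℂ 2 arc) :
    mulOp χ (mulOp ψ f) = mulOp ω f := by
  refine Lp.ext ?_
  filter_upwards [mulOp_coe χ (mulOp ψ f), mulOp_coe ψ f, mulOp_coe ω f, h] with x h1 h2 h3 h4
  rw [h1, h2, h3, ← h4, mul_assoc]

theorem fourierCoeff_mulOp_fourierLp (χ : Lp ℂ ∞ arc) (k m : ℤ) :
    fourierCoeff (mulOp χ (fourierLp 2 k)) m = fourierCoeff χ (m - k) := by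
  refine integral_congr_ae ?_
  filter_upwards [mulOp_coe χ (fourierLp 2 k), coeFn_fourierLp (T := 2 * π) 2 k] with x h1 h2
  rw [h1, h2, show -(m - k) = -m + k by ring, fourier_add, smul_eq_mul, smul_eq_mul]
  ring

theorem fourierCoeff_mulOp_fourier (k m : ℤ) (f : Lp ℂ 2 arc) :
    fourierCoeff (mulOp (fourierLp ∞ k) f) m = fourierCoeff f (m - k) := by
  refine integral_congr_ae ?_
  filter_upwards [mulOp_coe (fourierLp ∞ k) f, coeFn_fourierLp (T := 2 * π) ∞ k] with x h1 h2
  rw [h1, h2, show -(m - k) = -m + k by ring, fourier_add, smul_eq_mul, smul_eq_mul]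
  ring

/-- A bounded symbol whose Fourier coefficients of negative index vanish, that is, a member of
`H^∞`. -/
def IsAnalyticSymbol (χ : Lp ℂ ∞ arc) : Prop := ∀ m : ℤ, m < 0 → fourierCoeff χ m = 0

/-- The coefficient `⟪e_m, χ f⟫` is the sum over `k` of `f̂(k) χ̂(m - k)`, in which every term
vanishes when `m < 0`. -/
theorem IsAnalyticSymbol.mulOp_mem_H2 {χ : Lp ℂ ∞ arc} (hχ : IsAnalyticSymbol χ)
    {f : Lp ℂ 2 arc} (hf : f ∈ H2) : mulOp χ f ∈ H2 := by
  intro m hm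
  have hs := (innerSL ℂ (fourierLp (T := 2 * π) 2 m) ∘L mulOp χ).hasSum
    (hasSum_fourier_series_L2 f)
  rw [← fourierBasis_repr, HilbertBasis.repr_apply_apply, coe_fourierBasis]
  refine hs.unique ?_
  convert! hasSum_zero with k
  rw [map_smul, ContinuousLinearMap.comp_apply, innerSL_apply_apply, ← coe_fourierBasis,
    ← HilbertBasis.repr_apply_apply, fourierBasis_repr, coe_fourierBasis,
    fourierCoeff_mulOp_fourierLp, smul_eq_mul]
  rcases lt_or_ge k 0 with hk | hk
  · rw [hf k hk, zero_mul]
  · rw [hχ _ (by omega), mul_zero]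

theorem isAnalyticSymbol_fourierLp {k : ℤ} (hk : 0 ≤ k) :
    IsAnalyticSymbol (fourierLp ∞ k) := by
  intro m hm
  rw [fourierCoeff_congr_ae (coeFn_fourierLp (T := 2 * π) ∞ k), fourierCoeff_fourier]
  exact Pi.single_eq_of_ne (by omega) _

theorem isAnalyticSymbol_oneSubPowSymbol {α : ℝ} (hα : 0 < α) :
    IsAnalyticSymbol (oneSubPowSymbol α hα) := by
  intro m hm
  have h := oneSubPow_mem_H2 α hα m hm
  rw [fourierCoeff_toLp] at h
  rw [← h]
  exact congrFun (fourierCoeff_congr_ae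
    (ContinuousMap.coeFn_toLp (p := ∞) (𝕜 := ℂ) arc (oneSubPow α hα))) m

/-! ### Toeplitz operators -/

theorem toeplitz_apply (χ : Lp ℂ ∞ arc) (f : H2) :
    toeplitz χ f = H2.orthogonalProjectionOnto (mulOp χ f) := rfl

theorem coe_toeplitz {χ : Lp ℂ ∞ arc} (hχ : IsAnalyticSymbol χ) (f : H2) :
    (toeplitz χ f : Lp ℂ 2 arc) = mulOp χ f := by
  rw [toeplitz_apply]
  exact congrArg Subtype.val
    (Submodule.orthogonalProjectionOnto_mem_subspace_eq_self ⟨_, hχ.mulOp_mem_H2 f.2⟩)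

theorem adjoint_toeplitz (χ : Lp ℂ ∞ arc) :
    ContinuousLinearMap.adjoint (toeplitz χ) = toeplitz (star χ) := by
  symm
  rw [ContinuousLinearMap.eq_adjoint_iff]
  intro f g
  rw [toeplitz_apply, toeplitz_apply, Submodule.inner_orthogonalProjectionOnto_eq_of_mem_right,
    Submodule.inner_orthogonalProjectionOnto_eq_of_mem_left, inner_mulOp_left, star_star]

theorem toeplitz_comp_of_analytic_right {χ ψ ω : Lp ℂ ∞ arc} (hψ : IsAnalyticSymbol ψ)
    (h : ∀ᵐ x ∂arc, χ x * ψ x = ω x) : toeplitz χ ∘L toeplitz ψ = toeplitz ω := by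
  ext1 f
  rw [ContinuousLinearMap.comp_apply, toeplitz_apply, coe_toeplitz hψ, mulOp_mulOp h,
    toeplitz_apply]

/-- The adjoint of `toeplitz_comp_of_analytic_right`. -/
theorem toeplitz_comp_of_coanalytic_left {χ ψ ω : Lp ℂ ∞ arc} (hχ : IsAnalyticSymbol (star χ))
    (h : ∀ᵐ x ∂arc, χ x * ψ x = ω x) : toeplitz χ ∘L toeplitz ψ = toeplitz ω := by
  have h' : ∀ᵐ x ∂arc, (star ψ) x * (star χ) x = (star ω) x := by
    filter_upwards [h, Lp.coeFn_star χ, Lp.coeFn_star ψ, Lp.coeFn_star ω] with x h1 h2 h3 h4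
    rw [h2, h3, h4, Pi.star_apply, Pi.star_apply, Pi.star_apply, ← h1, star_mul]
  have := congrArg ContinuousLinearMap.adjoint (toeplitz_comp_of_analytic_right hχ h')
  simpa only [ContinuousLinearMap.adjoint_comp, adjoint_toeplitz, star_star] using this

/-- If the values of `ψ` lie in a half-plane at positive distance from the origin, then the
quadratic form of `T_ψ` is bounded below, and the Lax–Milgram theorem applies. -/
theorem isUnit_toeplitz {ψ : Lp ℂ ∞ arc} {u : ℂ} (hu : ‖u‖ = 1) {δ : ℝ} (hδ : 0 < δ)
    (h : ∀ᵐ x ∂arc, δ ≤ (u * ψ x).re) : IsUnit (toeplitz ψ) := by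
  refine (toeplitz ψ).isUnit_of_forall_le_norm_inner_map (c := ⟨δ, hδ.le⟩) hδ fun f => ?_
  rw [toeplitz_apply, Submodule.inner_orthogonalProjectionOnto_eq_of_mem_right,
    norm_inner_symm]
  have hint := L2.integrable_inner (𝕜 := ℂ) (f : Lp ℂ 2 arc) (f : Lp ℂ 2 arc)
  calc ‖f‖ ^ 2 * δ = ∫ x, (⟪(f : Lp ℂ 2 arc) x, (f : Lp ℂ 2 arc) x⟫_ℂ).re * δ ∂arc := by
        rw [integral_mul_const, show ‖f‖ = ‖(f : Lp ℂ 2 arc)‖ from rfl,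
          norm_sq_eq_re_inner (𝕜 := ℂ), L2.inner_def]
        exact congrArg (· * δ) (integral_re hint).symm
    _ ≤ ∫ x, (u * ⟪(f : Lp ℂ 2 arc) x, mulOp ψ f x⟫_ℂ).re ∂arc := by
        refine integral_mono_ae (hint.re.mul_const _)
          ((L2.integrable_inner _ _).const_mul u).re ?_
        filter_upwards [h, mulOp_coe ψ f] with x h1 h2
        have h3 : u * ⟪(f : Lp ℂ 2 arc) x, mulOp ψ f x⟫_ℂ =
            Complex.normSq ((f : Lp ℂ 2 arc) x) * (u * ψ x) := by
          rw [h2, RCLike.inner_apply, Complex.normSq_eq_conj_mul_self]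
          ring
        have h4 : (⟪(f : Lp ℂ 2 arc) x, (f : Lp ℂ 2 arc) x⟫_ℂ).re =
            Complex.normSq ((f : Lp ℂ 2 arc) x) := by
          rw [RCLike.inner_apply, Complex.mul_conj, Complex.ofReal_re]
        rw [h3, h4, Complex.re_ofReal_mul]
        exact mul_le_mul_of_nonneg_left h1 (Complex.normSq_nonneg _)
    _ = (u * ⟪(f : Lp ℂ 2 arc), mulOp ψ f⟫_ℂ).re := by
        rw [L2.inner_def, ← integral_const_mul]
        exact integral_re ((L2.integrable_inner _ _).const_mul u)
    _ ≤ ‖u * ⟪(f : Lp ℂ 2 arc), mulOp ψ f⟫_ℂ‖ := Complex.re_le_norm _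
    _ = ‖⟪(f : Lp ℂ 2 arc), mulOp ψ f⟫_ℂ‖ := by rw [norm_mul, hu, one_mul]

/-! ### The shift and its adjoint -/

theorem star_fourierLp (k : ℤ) :
    star (fourierLp (T := 2 * π) ∞ k) = fourierLp ∞ (-k) := by
  refine Lp.ext ?_
  filter_upwards [Lp.coeFn_star (fourierLp (T := 2 * π) ∞ k), coeFn_fourierLp (T := 2 * π) ∞ k,
    coeFn_fourierLp (T := 2 * π) ∞ (-k)] with x h1 h2 h3
  rw [h1, h3, Pi.star_apply, h2, fourier_neg]
  rfl

theorem backwardShift_eq_toeplitz : backwardShift = toeplitz (fourierLp ∞ (-1)) := by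
  rw [backwardShift, shift, adjoint_toeplitz, star_fourierLp]

theorem fourierLp_mul_fourierLp (j k : ℤ) :
    ∀ᵐ x ∂arc, fourierLp (T := 2 * π) ∞ j x * fourierLp (T := 2 * π) ∞ k x =
      fourierLp (T := 2 * π) ∞ (j + k) x := by
  filter_upwards [coeFn_fourierLp (T := 2 * π) ∞ j, coeFn_fourierLp (T := 2 * π) ∞ k,
    coeFn_fourierLp (T := 2 * π) ∞ (j + k)] with x h1 h2 h3
  rw [h1, h2, h3, fourier_add]

theorem toeplitz_fourierLp_zero : toeplitz (fourierLp ∞ 0) = 1 := by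
  ext1 f
  refine Subtype.ext ?_
  rw [coe_toeplitz (isAnalyticSymbol_fourierLp le_rfl)]
  refine Lp.ext ?_
  filter_upwards [mulOp_coe (fourierLp ∞ 0) (f : Lp ℂ 2 arc), coeFn_fourierLp (T := 2 * π) ∞ 0]
    with x h1 h2
  rw [h1, h2, fourier_zero, one_mul, one_apply_eq_self]

theorem backwardShift_mul_shift : backwardShift * shift = 1 := by
  rw [backwardShift_eq_toeplitz, shift, ← toeplitz_fourierLp_zero]
  exact toeplitz_comp_of_analytic_right (isAnalyticSymbol_fourierLp zero_le_one)
    (fourierLp_mul_fourierLp (-1) 1)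

theorem backwardShift_pow (k : ℕ) : backwardShift ^ k = toeplitz (fourierLp ∞ (-(k : ℤ))) := by
  induction k with
  | zero => rw [pow_zero, Nat.cast_zero, neg_zero, toeplitz_fourierLp_zero]
  | succ k ih =>
    rw [pow_succ', ih, backwardShift_eq_toeplitz]
    refine toeplitz_comp_of_coanalytic_left ?_ ?_
    · rw [star_fourierLp]
      exact isAnalyticSymbol_fourierLp (by norm_num)
    · have h := fourierLp_mul_fourierLp (-1) (-(k : ℤ))
      rwa [show (-1 : ℤ) + -(k : ℤ) = -((k + 1 : ℕ) : ℤ) by push_cast; ring] at h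

theorem commute_toeplitz_shift {χ : Lp ℂ ∞ arc} (hχ : IsAnalyticSymbol χ) :
    Commute (toeplitz χ) shift := by
  have h1 := isAnalyticSymbol_fourierLp zero_le_one
  ext1 f
  refine Subtype.ext ?_
  change (toeplitz χ (shift f) : Lp ℂ 2 arc) = shift (toeplitz χ f)
  rw [shift, coe_toeplitz hχ, coe_toeplitz h1, coe_toeplitz h1, coe_toeplitz hχ]
  refine Lp.ext ?_
  filter_upwards [mulOp_coe χ (mulOp (fourierLp ∞ 1) f), mulOp_coe (fourierLp ∞ 1) f,
    mulOp_coe (fourierLp ∞ 1) (mulOp χ f), mulOp_coe χ f] with x h1 h2 h3 h4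
  rw [h1, h2, h3, h4]
  ring

/-- The constant function `1` in `H²`. -/
def constOne : H2 :=
  ⟨fourierLp 2 0, fun m hm => by
    rw [fourierCoeff_congr_ae (coeFn_fourierLp (T := 2 * π) 2 0), fourierCoeff_fourier]
    exact Pi.single_eq_of_ne hm.ne _⟩

/-- The constant is `f̂(0)`, and `g = z̄ (f - f̂(0))`. -/
theorem exists_eq_shift_add_const (f : H2) : ∃ (g : H2) (c : ℂ), f = shift g + c • constOne := by
  set c := fourierCoeff (f : Lp ℂ 2 arc) 0 with hc
  have hcoeff (m : ℤ) : fourierCoeff ((f - c • constOne : H2) : Lp ℂ 2 arc) m =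
      fourierCoeff (f : Lp ℂ 2 arc) m - c * (Pi.single 0 1 : ℤ → ℂ) m := by
    have h1 : fourierCoeff (constOne : Lp ℂ 2 arc) m = (Pi.single 0 1 : ℤ → ℂ) m := by
      rw [constOne, fourierCoeff_congr_ae (coeFn_fourierLp (T := 2 * π) 2 0), fourierCoeff_fourier]
    rw [← h1, ← fourierBasis_repr, ← fourierBasis_repr, ← fourierBasis_repr]
    simp only [Submodule.coe_sub, Submodule.coe_smul, map_sub, map_smul, lp.coeFn_sub,
      lp.coeFn_smul, Pi.sub_apply, Pi.smul_apply, smul_eq_mul]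
  have hg : mulOp (fourierLp ∞ (-1)) (f - c • constOne : H2) ∈ H2 := by
    intro m hm
    rw [fourierCoeff_mulOp_fourier, hcoeff, sub_neg_eq_add]
    rcases eq_or_ne (m + 1) 0 with h | h
    · rw [h, Pi.single_eq_same, mul_one, ← hc, sub_self]
    · rw [Pi.single_eq_of_ne h, mul_zero, sub_zero]
      exact f.2 _ (by omega)
  refine ⟨⟨_, hg⟩, c, ?_⟩
  rw [← sub_eq_iff_eq_add]
  refine Subtype.ext ?_
  rw [shift, coe_toeplitz (isAnalyticSymbol_fourierLp zero_le_one),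
    mulOp_mulOp (fourierLp_mul_fourierLp 1 (-1))]
  rw [add_neg_cancel, ← coe_toeplitz (isAnalyticSymbol_fourierLp le_rfl), toeplitz_fourierLp_zero,
    one_apply_eq_self]

/-- `S*ⁿ⁺¹ T_χ (S g + c) = S*ⁿ T_χ g + c S*ⁿ⁺¹ T_χ 1`, so passing from `n` to `n + 1` adjoins the line
spanned by `S*ⁿ⁺¹ T_χ 1` to the range. -/
theorem range_backwardShift_pow_mul_toeplitz {χ : Lp ℂ ∞ arc} (hχ : IsAnalyticSymbol χ) (n : ℕ) :
    LinearMap.range ((backwardShift ^ n * toeplitz χ : H2 →L[ℂ] H2) : H2 →ₗ[ℂ] H2) =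
      rangeSpace χ ⊔ Submodule.span ℂ
        {f | ∃ k : ℕ, 1 ≤ k ∧ k ≤ n ∧ f = (backwardShift ^ k) (toeplitz χ constOne)} := by
  induction n with
  | zero =>
    have : {f | ∃ k : ℕ, 1 ≤ k ∧ k ≤ 0 ∧ f = (backwardShift ^ k) (toeplitz χ constOne)} = ∅ := by
      ext f
      simp only [Set.mem_ofPred_eq, Set.mem_empty_iff_false, iff_false]
      rintro ⟨k, h1, h2, -⟩
      omega
    rw [this, Submodule.span_empty, sup_bot_eq, pow_zero, one_mul, rangeSpace]
  | succ n ih =>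
    have hset : {f | ∃ k : ℕ, 1 ≤ k ∧ k ≤ n + 1 ∧ f = (backwardShift ^ k) (toeplitz χ constOne)} =
        insert ((backwardShift ^ (n + 1)) (toeplitz χ constOne))
          {f | ∃ k : ℕ, 1 ≤ k ∧ k ≤ n ∧ f = (backwardShift ^ k) (toeplitz χ constOne)} := by
      ext f
      simp only [Set.mem_ofPred_eq, Set.mem_insert_iff]
      constructor
      · rintro ⟨k, h1, h2, rfl⟩
        rcases Nat.le_succ_iff.mp h2 with h | rfl
        · exact Or.inr ⟨k, h1, h, rfl⟩
        · exact Or.inl rfl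
      · rintro (rfl | ⟨k, h1, h2, rfl⟩)
        · exact ⟨n + 1, by omega, le_rfl, rfl⟩
        · exact ⟨k, h1, by omega, rfl⟩
    have hshift : backwardShift ^ (n + 1) * toeplitz χ * shift = backwardShift ^ n * toeplitz χ := by
      rw [mul_assoc, (commute_toeplitz_shift hχ).eq, pow_succ, mul_assoc,
        ← mul_assoc backwardShift, backwardShift_mul_shift, one_mul]
    have hshift' (g : H2) : (backwardShift ^ (n + 1) * toeplitz χ) (shift g) =
        (backwardShift ^ n * toeplitz χ) g := by
      rw [← hshift]
      rfl
    rw [hset, Submodule.span_insert, sup_left_comm, ← ih]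
    apply le_antisymm
    · rintro _ ⟨f, rfl⟩
      obtain ⟨g, c, rfl⟩ := exists_eq_shift_add_const f
      rw [ContinuousLinearMap.coe_coe, map_add, map_smul, hshift',
        add_comm ((backwardShift ^ n * toeplitz χ) g)]
      exact Submodule.add_mem_sup
        (Submodule.smul_mem _ _ (Submodule.mem_span_singleton_self _)) ⟨g, rfl⟩
    · refine sup_le ?_ ?_
      · rw [Submodule.span_singleton_le_iff_mem]
        exact ⟨constOne, rfl⟩
      · rintro _ ⟨g, rfl⟩
        exact ⟨shift g, hshift' g⟩

/-! ### The boundary argument of `1 - z` -/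

/-- The conjugate of `(1 - z)^α` differs from `z̄ⁿ (1 - z)^α` by the unimodular factor
`(-1)ⁿ exp (2i(α - n) arg (1 - z))`, because `z̄ = -exp (-2i arg (1 - z))` on the circle. -/
theorem star_oneSubPow_mul {z : ℂ} (hz : ‖z‖ = 1) {α : ℝ} (hα : 0 < α) (n : ℕ) :
    star ((1 - z) ^ (α : ℂ)) *
        ((-1) ^ n * Complex.exp ((2 * (α - n) * (1 - z).arg : ℝ) * Complex.I)) =
      star z ^ n * (1 - z) ^ (α : ℂ) := by
  rcases eq_or_ne (1 - z) 0 with h0 | h0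
  -- At `z = 1` both sides vanish, since `0 ^ α = 0` for `α ≠ 0`.
  · have : (α : ℂ) ≠ 0 := by exact_mod_cast hα.ne'
    simp [h0, this]
  have hzz : z * star z = 1 := by
    rw [Complex.star_def, Complex.mul_conj, Complex.normSq_eq_norm_sq, hz]; simp
  obtain ⟨L, θ, hθ, hw⟩ : ∃ L θ : ℝ, (1 - z).arg = θ ∧
      Complex.log (1 - z) = L + θ * Complex.I :=
    ⟨_, _, rfl, rfl⟩
  have hw1 : 1 - z = Complex.exp (L + θ * Complex.I) := by rw [← hw, Complex.exp_log h0]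
  have hw2 : 1 - star z = Complex.exp (L - θ * Complex.I) := by
    have := congrArg star hw1
    rw [star_sub, star_one, Complex.star_def, ← Complex.exp_conj] at this
    rw [Complex.star_def, this]
    simp [sub_eq_add_neg]
  have hz2 : star z = -Complex.exp (-(2 * θ * Complex.I)) := by
    have h1 : star z * (1 - z) = -(1 - star z) := by linear_combination -hzz
    rw [hw2] at h1
    rw [eq_div_of_mul_eq h0 h1, hw1, neg_div, ← Complex.exp_sub]
    ring_nf
  have hconj : star ((1 - z) ^ (α : ℂ)) = Complex.exp ((L - θ * Complex.I) * α) := by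
    rw [Complex.cpow_def_of_ne_zero h0, hw, Complex.star_def, ← Complex.exp_conj]
    simp [sub_eq_add_neg]
  rw [hconj, Complex.cpow_def_of_ne_zero h0, hw, hz2, neg_pow (Complex.exp _),
    ← Complex.exp_nat_mul, hθ, mul_left_comm, mul_assoc ((-1) ^ n), ← Complex.exp_add, ← Complex.exp_add]
  congr 2
  push_cast
  ring

theorem cos_le_cos_two_mul_arg_oneSub {z : ℂ} (hz : ‖z‖ ≤ 1) {β : ℝ} (hβ : |β| ≤ 1) :
    Real.cos (π * |β|) ≤ Real.cos (2 * β * (1 - z).arg) := by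
  have harg : |(1 - z).arg| ≤ π / 2 := by
    rw [Complex.abs_arg_le_pi_div_two_iff]
    simpa using (Complex.re_le_norm z).trans hz
  rw [← Real.cos_abs (2 * β * _)]
  refine Real.cos_le_cos_of_nonneg_of_le_pi (abs_nonneg _) ?_ ?_
  · nlinarith [Real.pi_pos]
  · rw [abs_mul, abs_mul, abs_two]
    nlinarith [abs_nonneg β]

/-! ### The factorization and the range of the co-analytic operator -/

/-- The unimodular symbol `(-1)ⁿ exp (2i(α - n) arg (1 - z))`, equal to the quotient of
`z̄ⁿ (1 - z)^α` by the conjugate of `(1 - z)^α` away from `z = 1`. -/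
def argSymbol (α : ℝ) (n : ℕ) : Lp ℂ ∞ arc :=
  MemLp.toLp (fun x : Circ => (-1) ^ n *
      Complex.exp ((2 * (α - n) * (1 - (toCircle x : ℂ)).arg : ℝ) * Complex.I)) <| by
    refine memLp_top_of_bound (C := 1) (Measurable.aestronglyMeasurable ?_) (.of_forall fun x => ?_)
    · have h : Measurable fun x : Circ => (toCircle x : ℂ) :=
        (continuous_induced_dom.comp AddCircle.continuous_toCircle).measurable
      fun_prop
    · rw [norm_mul, norm_pow, norm_neg, norm_one, one_pow, one_mul, Complex.norm_exp_ofReal_mul_I]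

theorem argSymbol_coe (α : ℝ) (n : ℕ) : argSymbol α n =ᵐ[arc] fun x => (-1) ^ n *
    Complex.exp ((2 * (α - n) * (1 - (toCircle x : ℂ)).arg : ℝ) * Complex.I) :=
  MemLp.coeFn_toLp _

theorem oneSubPowSymbol_coe {α : ℝ} (hα : 0 < α) :
    oneSubPowSymbol α hα =ᵐ[arc] fun x => (1 - (toCircle x : ℂ)) ^ (α : ℂ) :=
  ContinuousMap.coeFn_toLp (p := ∞) (𝕜 := ℂ) arc _

theorem toeplitz_argSymbol_surjective {α : ℝ} {n : ℕ} (h : |α - n| < 1 / 2) :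
    Function.Surjective (toeplitz (argSymbol α n)) := by
  have hδ : 0 < Real.cos (π * |α - n|) := by
    refine Real.cos_pos_of_mem_Ioo ⟨?_, ?_⟩ <;> nlinarith [Real.pi_pos, abs_nonneg (α - n)]
  have hu : ‖((-1) ^ n : ℂ)‖ = 1 := by rw [norm_pow, norm_neg, norm_one, one_pow]
  have hunit : IsUnit (toeplitz (argSymbol α n)) := by
    refine isUnit_toeplitz hu hδ ?_
    filter_upwards [argSymbol_coe α n] with x hx
    rw [hx, ← mul_assoc, ← mul_pow, neg_one_mul, neg_neg, one_pow, one_mul,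
      Complex.exp_ofReal_mul_I_re]
    exact cos_le_cos_two_mul_arg_oneSub (Circle.norm_coe _).le (by linarith)
  exact (ContinuousLinearMap.isUnit_iff_bijective.mp hunit).2

/-- The symbol `z̄ⁿ (1 - z)^α`. -/
def fourierMulOneSubPow (α : ℝ) (hα : 0 < α) (n : ℕ) : Lp ℂ ∞ arc :=
  ContinuousMap.toLp ∞ arc ℂ (fourier (-(n : ℤ)) * oneSubPow α hα)

theorem toeplitz_star_oneSubPowSymbol_mul_argSymbol {α : ℝ} (hα : 0 < α) (n : ℕ) :
    toeplitz (star (oneSubPowSymbol α hα)) * toeplitz (argSymbol α n) =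
      backwardShift ^ n * toeplitz (oneSubPowSymbol α hα) := by
  have ha := isAnalyticSymbol_oneSubPowSymbol hα
  have hcomp := toeplitz_comp_of_coanalytic_left (χ := star (oneSubPowSymbol α hα))
    (ψ := argSymbol α n) (ω := fourierMulOneSubPow α hα n) (by rwa [star_star]) ?_
  have hcomp' := toeplitz_comp_of_analytic_right (χ := fourierLp ∞ (-(n : ℤ)))
    (ω := fourierMulOneSubPow α hα n) ha ?_
  · rw [backwardShift_pow]
    exact hcomp.trans hcomp'.symm
  · filter_upwards [coeFn_fourierLp (T := 2 * π) ∞ (-(n : ℤ)), oneSubPowSymbol_coe hα,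
      ContinuousMap.coeFn_toLp (p := ∞) (𝕜 := ℂ) arc (fourier (-(n : ℤ)) * oneSubPow α hα)]
      with x h1 h2 h3
    rw [h1, h2]
    exact h3.symm
  · filter_upwards [Lp.coeFn_star (oneSubPowSymbol α hα), oneSubPowSymbol_coe hα,
      argSymbol_coe α n,
      ContinuousMap.coeFn_toLp (p := ∞) (𝕜 := ℂ) arc (fourier (-(n : ℤ)) * oneSubPow α hα)]
      with x h1 h2 h3 h4
    rw [h1, Pi.star_apply, h2, h3, star_oneSubPow_mul (Circle.norm_coe _) hα n]
    refine Eq.trans ?_ h4.symm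
    rw [ContinuousMap.mul_apply, fourier_neg, fourier_apply, toCircle_zsmul, zpow_natCast,
      Circle.coe_pow, map_pow]
    rfl

theorem toeplitz_oneSubPowSymbol_constOne {α : ℝ} (hα : 0 < α) :
    toeplitz (oneSubPowSymbol α hα) constOne = oneSubPowVec α hα := by
  refine Subtype.ext ?_
  rw [coe_toeplitz (isAnalyticSymbol_oneSubPowSymbol hα)]
  refine Lp.ext ?_
  filter_upwards [mulOp_coe (oneSubPowSymbol α hα) (constOne : Lp ℂ 2 arc),
    coeFn_fourierLp (T := 2 * π) 2 0,
    ContinuousMap.coeFn_toLp (p := 2) (𝕜 := ℂ) arc (oneSubPow α hα),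
    ContinuousMap.coeFn_toLp (p := ∞) (𝕜 := ℂ) arc (oneSubPow α hα)] with x h1 h2 h3 h4
  rw [h1, constOne, oneSubPowVec, h2, h3, oneSubPowSymbol, h4, fourier_zero, mul_one]

end HardyToeplitz

end

/-- For `n ≥ 1` and `n - 1/2 < α < n + 1/2`, as subspaces of `H²`,
`M(conj (1-z)^α) = M((1-z)^α) + span {S* (1-z)^α, …, S*ⁿ (1-z)^α}`. -/
theorem theorem3p1 (n : ℕ) (hn : 1 ≤ n) (α : ℝ)
    (hlow : (n : ℝ) - 1 / 2 < α) (hupp : α < (n : ℝ) + 1 / 2) :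
    HardyToeplitz.rangeSpace
        (star (HardyToeplitz.oneSubPowSymbol α (HardyToeplitz.exponent_pos hn hlow))) =
      HardyToeplitz.rangeSpace
          (HardyToeplitz.oneSubPowSymbol α (HardyToeplitz.exponent_pos hn hlow)) ⊔
        Submodule.span ℂ
          {f | ∃ k : ℕ, 1 ≤ k ∧ k ≤ n ∧
            f = (HardyToeplitz.backwardShift ^ k)
              (HardyToeplitz.oneSubPowVec α (HardyToeplitz.exponent_pos hn hlow))} := by
  have hα := HardyToeplitz.exponent_pos hn hlow
  have hsurj := HardyToeplitz.toeplitz_argSymbol_surjective (α := α) (n := n)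
    (abs_sub_lt_iff.mpr ⟨by linarith, by linarith⟩)
  rw [← HardyToeplitz.toeplitz_oneSubPowSymbol_constOne hα,
    ← HardyToeplitz.range_backwardShift_pow_mul_toeplitz
      (HardyToeplitz.isAnalyticSymbol_oneSubPowSymbol hα),
    ← HardyToeplitz.toeplitz_star_oneSubPowSymbol_mul_argSymbol hα]
  exact (LinearMap.range_comp_of_range_eq_top _ (LinearMap.range_eq_top.mpr hsurj)).symm
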